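/- Let $d\ge 0$ be an integer, $m>0$ and $L>0$. Let $\mathcal S'(\mathbb R^{d+1})$ be the space of real tempered distributions, with the $\sigma$-algebra generated by the evaluations $\phi\mapsto\phi(f)$, $f\in\mathcal S(\mathbb R^{d+1})$ (real Schwartz functions), and let $\mu_{C_m}$ be the free massive scalar field measure on it, i.e. the Gaussian probability measure with covariance $C_m=(-\Delta+m^2)^{-1}$, characterized by $$\int_{\mathcal S'(\mathbb R^{d+1})} e^{i\phi(f)}\,d\mu_{C_m}(\phi)=e^{-\frac12 (f,C_m f)_{L^2}},\qquad f\in\mathcal S(\mathbb R^{d+1}).$$ For $n\in\mathbb N$ let $B_n\subset\mathbb R^{d+1}$ be the cube of side $L$ with sides parallel to the coordinate axes, centred at $(n^2/m,0,\dots,0)$, let $f_n=L^{-(d+1)}\mathbf 1_{B_n}$, and let $\phi(f_n)$, the mean value of $\phi$ over $B_n$, be the random variable in $L^2(\mu_{C_m})$ obtained by extending $f\mapsto\phi(f)$ by continuity from $\mathcal S(\mathbb R^{d+1})$ to $L^2(\mathbb R^{d+1})$ (it is defined up to $\mu_{C_m}$-null sets). Put $$C_m^L=\Big(\frac2\pi\Big)^{d+1}\frac1{L^{2(d+1)}}\int_{\mathbb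 R^{d+1}}\frac{1}{p^2+m^2}\prod_{k=0}^{d}\frac{\sin^2(p_kL/2)}{p_k^2}\,d^{d+1}p .$$ Then $C_m^L$ is the variance of $\phi(f_n)$ for every $n$, and for every $\varepsilon>0$ the set $$\Big\{\phi\in\mathcal S'(\mathbb R^{d+1}) : \exists N_\phi\in\mathbb N\ \text{ such that }\ |\phi(f_n)|<\sqrt{2(1+\varepsilon)\,C_m^L\,\ln n}\ \text{ for all } n\ge N_\phi\Big\}$$ has $\mu_{C_m}$-measure one. -/

import Mathlib

open MeasureTheory ProbabilityTheory
open scoped SchwartzMap ENNReal NNReal Laplacian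

noncomputable section

namespace FreeField

/-- Euclidean space-time `ℝ^{d+1}`; the coordinate `0` is the time coordinate. -/
abbrev SpaceTime (d : ℕ) : Type := EuclideanSpace ℝ (Fin (d + 1))

/-- The space `𝓢'(ℝ^{d+1})` of real tempered distributions: the continuous linear functionals on
the space of real Schwartz functions. -/
abbrev Field (d : ℕ) : Type := 𝓢(SpaceTime d, ℝ) →L[ℝ] ℝ

/-- The cylinder `σ`-algebra on `𝓢'(ℝ^{d+1})`: the smallest one for which all the evaluations
`φ ↦ φ(f)`, `f ∈ 𝓢(ℝ^{d+1})`, are measurable. -/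
instance instMeasurableSpaceField (d : ℕ) : MeasurableSpace (Field d) :=
  MeasurableSpace.comap (fun (φ : Field d) (f : 𝓢(SpaceTime d, ℝ)) => φ f) MeasurableSpace.pi

theorem measurable_eval {d : ℕ} (f : 𝓢(SpaceTime d, ℝ)) :
    Measurable (fun φ : Field d => φ f) :=
  (measurable_pi_apply f).comp (comap_measurable _)

/-- The operator `-Δ + m²` on the real Schwartz space. -/
def massiveOp (d : ℕ) (m : ℝ) : 𝓢(SpaceTime d, ℝ) →ₗ[ℝ] 𝓢(SpaceTime d, ℝ) where
  toFun u := -(Δ u) + m ^ 2 • u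
  map_add' u v := by
    simp only [← SchwartzMap.laplacianCLM_eq', map_add, smul_add]; abel
  map_smul' c u := by
    simp only [← SchwartzMap.laplacianCLM_eq', map_smul, smul_add, smul_neg, RingHom.id_apply,
      smul_comm c]

theorem massiveOp_apply {d : ℕ} {m : ℝ} (u : 𝓢(SpaceTime d, ℝ)) :
    massiveOp d m u = -(Δ u) + m ^ 2 • u := rfl

theorem integrable_mul {d : ℕ} (u v : 𝓢(SpaceTime d, ℝ)) :
    Integrable (fun x => u x * v x) volume :=
  (u.memLp 2 volume).integrable_mul (v.memLp 2 volume)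

theorem integral_mul_laplacian_nonpos {d : ℕ} (u : 𝓢(SpaceTime d, ℝ)) :
    ∫ x, u x * (Δ u) x ≤ 0 := by
  simp_rw [SchwartzMap.laplacian_eq_sum (stdOrthonormalBasis ℝ (SpaceTime d)), _root_.sum_apply,
    Finset.mul_sum]
  rw [integral_finsetSum _ (fun i _ => integrable_mul u _)]
  refine Finset.sum_nonpos fun i _ => ?_
  rw [SchwartzMap.integral_mul_lineDerivOp_right_eq_neg_left]
  exact neg_nonpos.mpr (integral_nonneg fun x => mul_self_nonneg _)

theorem sq_le_integral_massiveOp {d : ℕ} {m : ℝ} (u : 𝓢(SpaceTime d, ℝ)) :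
    m ^ 2 * ∫ x, u x ^ 2 ≤ ∫ x, massiveOp d m u x * u x := by
  have h1 : ∀ x, massiveOp d m u x * u x = -(u x * (Δ u) x) + m ^ 2 * (u x * u x) := fun x => by
    simp only [massiveOp_apply, _root_.add_apply, _root_.neg_apply,
      _root_.smul_apply, smul_eq_mul]
    ring
  simp_rw [h1]
  have h2 : Integrable (fun x => -(u x * (Δ u) x)) volume := (integrable_mul u (Δ u)).neg
  rw [integral_add h2 ((integrable_mul u u).const_mul _), integral_neg,
    integral_const_mul]
  simp_rw [pow_two (u _)]
  linarith [integral_mul_laplacian_nonpos u]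

theorem massiveOp_injective {d : ℕ} {m : ℝ} (hm : 0 < m) :
    Function.Injective (massiveOp d m) := by
  rw [injective_iff_map_eq_zero]
  intro u hu
  have h := sq_le_integral_massiveOp (m := m) u
  simp only [hu, _root_.zero_apply, zero_mul, integral_zero] at h
  have hm2 : 0 < m ^ 2 := by positivity
  have h0 : ∫ x, u x ^ 2 = 0 :=
    le_antisymm (by nlinarith) (integral_nonneg fun x => sq_nonneg _)
  have hi : Integrable (fun x => u x ^ 2) volume := by
    simpa only [pow_two] using integrable_mul u u
  rw [integral_eq_zero_iff_of_nonneg (fun x => sq_nonneg _) hi] at h0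
  have hc : Continuous fun x => u x ^ 2 := u.continuous.pow 2
  have h2 := (Continuous.ae_eq_iff_eq volume hc continuous_const).mp h0
  ext x
  exact pow_eq_zero_iff (two_ne_zero) |>.mp (congrFun h2 x)

theorem massiveOp_surjective {d : ℕ} {m : ℝ} (hm : 0 < m) :
    Function.Surjective (massiveOp d m) := by
  intro f
  have hg : (fun ξ : SpaceTime d => ((2 * Real.pi) ^ 2 * ‖ξ‖ ^ 2 + m ^ 2)⁻¹).HasTemperateGrowth := by
    have h1 := (Function.hasTemperateGrowth_one_add_norm_sq_rpow (SpaceTime d) (-1)).comp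
      ((2 * Real.pi / m) • ContinuousLinearMap.id ℝ (SpaceTime d)).hasTemperateGrowth
    have h2 := (Function.HasTemperateGrowth.const ((m ^ 2)⁻¹)).mul h1
    refine (congrArg Function.HasTemperateGrowth (funext fun ξ => ?_)).mpr h2
    have h3 : 0 < 1 + (2 * Real.pi / m * ‖ξ‖) ^ 2 := by positivity
    simp only [Function.comp, Pi.mul_apply, _root_.smul_apply,
      ContinuousLinearMap.id_apply, norm_smul, Real.norm_eq_abs,
      abs_of_pos (div_pos Real.two_pi_pos hm), Real.rpow_neg_one]
    rw [← mul_inv]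
    congr 1
    field_simp
    ring
  set F : 𝓢(SpaceTime d, ℂ) := f.postcompCLM Complex.ofRealCLM with hF
  set U := SchwartzMap.fourierMultiplierCLM ℂ
    (fun ξ : SpaceTime d => ((2 * Real.pi) ^ 2 * ‖ξ‖ ^ 2 + m ^ 2)⁻¹) F with hU
  have hn : (fun ξ : SpaceTime d => ‖ξ‖ ^ 2).HasTemperateGrowth := by fun_prop
  have hAU : -(Δ U) + m ^ 2 • U = F := by
    rw [SchwartzMap.laplacian_eq_fourierMultiplierCLM, hU,
      SchwartzMap.fourierMultiplierCLM_fourierMultiplierCLM_apply (by exact hn) hg]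
    have h1 := SchwartzMap.fourierMultiplierCLM_const (E := SpaceTime d) (F := ℂ) (1 : ℝ)
    have h2 : F = SchwartzMap.fourierMultiplierCLM ℂ (fun _ : SpaceTime d => (1 : ℝ)) F := by
      rw [h1]; simp
    conv_rhs => rw [h2]
    have hpos : ∀ ξ : SpaceTime d, (2 * Real.pi) ^ 2 * ‖ξ‖ ^ 2 + m ^ 2 ≠ 0 := fun ξ => by
      positivity
    have h3 : (fun _ : SpaceTime d => (1 : ℝ)) = fun ξ => ∑ i : Fin 2,
        (![(2 * Real.pi) ^ 2 • ((fun ξ : SpaceTime d => ‖ξ‖ ^ 2) *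
            fun ξ : SpaceTime d => ((2 * Real.pi) ^ 2 * ‖ξ‖ ^ 2 + m ^ 2)⁻¹),
          m ^ 2 • fun ξ : SpaceTime d => ((2 * Real.pi) ^ 2 * ‖ξ‖ ^ 2 + m ^ 2)⁻¹] i) ξ := by
      ext ξ
      have := hpos ξ
      simp only [Fin.sum_univ_two, Matrix.cons_val_zero, Matrix.cons_val_one, Pi.smul_apply,
        Pi.mul_apply, smul_eq_mul]
      field_simp
    rw [h3, SchwartzMap.fourierMultiplierCLM_sum]
    · simp only [Fin.sum_univ_two, Matrix.cons_val_zero, Matrix.cons_val_one]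
      rw [SchwartzMap.fourierMultiplierCLM_smul (hn.mul hg), SchwartzMap.fourierMultiplierCLM_smul hg]
      simp only [neg_smul, neg_neg]
      rfl
    · intro i _
      fin_cases i
      · exact (Function.HasTemperateGrowth.const ((2 * Real.pi) ^ 2)).mul (hn.mul hg)
      · exact (Function.HasTemperateGrowth.const (m ^ 2)).mul hg
  refine ⟨U.postcompCLM Complex.reCLM, ?_⟩
  ext x
  have hx := congrArg (fun G : 𝓢(SpaceTime d, ℂ) => (G x).re) hAU
  have hlap : (Δ (U.postcompCLM Complex.reCLM)) x = ((Δ U) x).re := by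
    rw [SchwartzMap.laplacian_apply, SchwartzMap.laplacian_apply]
    exact ((U.smooth 2).contDiffAt (x := x)).laplacian_CLM_comp_left (l := Complex.reCLM)
  simp only [massiveOp_apply, _root_.add_apply, _root_.neg_apply, _root_.smul_apply, hlap,
    SchwartzMap.postcompCLM_apply, hF, Complex.add_re, Complex.neg_re, Complex.smul_re] at hx ⊢
  exact hx

/-- The covariance operator `C_m = (-Δ + m²)⁻¹` on the real Schwartz space. -/
def covOp (d : ℕ) {m : ℝ} (hm : 0 < m) : 𝓢(SpaceTime d, ℝ) ≃ₗ[ℝ] 𝓢(SpaceTime d, ℝ) :=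
  (LinearEquiv.ofBijective (massiveOp d m)
    ⟨massiveOp_injective hm, massiveOp_surjective hm⟩).symm

theorem massiveOp_covOp {d : ℕ} {m : ℝ} (hm : 0 < m) (f : 𝓢(SpaceTime d, ℝ)) :
    massiveOp d m (covOp d hm f) = f :=
  LinearEquiv.apply_symm_apply (LinearEquiv.ofBijective (massiveOp d m)
    ⟨massiveOp_injective hm, massiveOp_surjective hm⟩) f

/-- The quadratic form `(f, C_m f)` of the covariance, where `( , )` is the inner product of
`L²(ℝ^{d+1})`. -/
def covForm (d : ℕ) {m : ℝ} (hm : 0 < m) (f : 𝓢(SpaceTime d, ℝ)) : ℝ :=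
  ∫ x, f x * covOp d hm f x

/-- `μ` is the measure `μ_{C_m}` of the free scalar field of mass `m`: the Gaussian probability
measure on `𝓢'(ℝ^{d+1})` with Fourier transform `χ(f) = exp (-(f, C_m f) / 2)`. -/
structure IsFreeFieldMeasure {d : ℕ} {m : ℝ} (hm : 0 < m) (μ : Measure (Field d)) : Prop where
  isProbabilityMeasure : IsProbabilityMeasure μ
  fourier_eq : ∀ f : 𝓢(SpaceTime d, ℝ),
    ∫ φ : Field d, Complex.exp (Complex.I * (φ f : ℂ)) ∂μ =
      Complex.exp (-(1 / 2 : ℂ) * (covForm d hm f : ℂ))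

variable {d : ℕ} {m : ℝ} {hm : 0 < m} {μ : Measure (Field d)}

theorem covForm_nonneg (hm : 0 < m) (f : 𝓢(SpaceTime d, ℝ)) : 0 ≤ covForm d hm f := by
  have h := sq_le_integral_massiveOp (m := m) (covOp d hm f)
  rw [massiveOp_covOp] at h
  exact le_trans (mul_nonneg (sq_nonneg _) (integral_nonneg fun x => sq_nonneg _)) h

theorem covForm_le (hm : 0 < m) (f : 𝓢(SpaceTime d, ℝ)) :
    covForm d hm f ≤ (1 / m * ‖f.toLp 2 volume‖) ^ 2 := by
  have h := sq_le_integral_massiveOp (m := m) (covOp d hm f)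
  rw [massiveOp_covOp] at h
  set u := covOp d hm f with hu
  have hN : ‖f.toLp 2 volume‖ ^ 2 = ∫ x, f x ^ 2 := by
    rw [← real_inner_self_eq_norm_sq, L2.inner_def]
    refine integral_congr_ae ?_
    filter_upwards [f.coeFn_toLp 2 volume] with x hx
    simp [hx, pow_two]
  have hC : 2 * ∫ x, f x * u x ≤ (1 / m ^ 2) * (∫ x, f x ^ 2) + m ^ 2 * ∫ x, u x ^ 2 := by
    have hf2 : Integrable (fun x => f x ^ 2) volume := by
      simpa only [pow_two] using integrable_mul f f
    have hu2 : Integrable (fun x => u x ^ 2) volume := by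
      simpa only [pow_two] using integrable_mul u u
    rw [← integral_const_mul, ← integral_const_mul, ← integral_const_mul,
      ← integral_add (hf2.const_mul _) (hu2.const_mul _)]
    refine integral_mono ((integrable_mul f u).const_mul _)
      ((hf2.const_mul _).add (hu2.const_mul _)) fun x => ?_
    have : 0 ≤ (f x / m - m * u x) ^ 2 := sq_nonneg _
    have e : (f x / m - m * u x) ^ 2 = 1 / m ^ 2 * f x ^ 2 + m ^ 2 * u x ^ 2 - 2 * (f x * u x) := by
      field_simp
      ring
    simp only
    linarith
  rw [mul_pow, hN, covForm, one_div_pow, ← hu]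
  linarith

theorem IsFreeFieldMeasure.map_eval (hμ : IsFreeFieldMeasure hm μ) (f : 𝓢(SpaceTime d, ℝ)) :
    μ.map (fun φ : Field d => φ f) = gaussianReal 0 (covForm d hm f).toNNReal := by
  have := hμ.isProbabilityMeasure
  have hmeas := measurable_eval f
  refine Measure.ext_of_charFun ?_
  ext t
  rw [charFun_gaussianReal, charFun_apply_real, integral_map hmeas.aemeasurable (by fun_prop)]
  have h := hμ.fourier_eq (t • f)
  have hq : covForm d hm (t • f) = t ^ 2 * covForm d hm f := by
    simp only [covForm, map_smul, _root_.smul_apply, smul_eq_mul, ← integral_const_mul]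
    refine integral_congr_ae (Filter.Eventually.of_forall fun x => ?_)
    ring
  rw [hq] at h
  have hv : (((covForm d hm f).toNNReal : ℝ) : ℂ) = (covForm d hm f : ℂ) := by
    rw [Real.coe_toNNReal _ (covForm_nonneg hm f)]
  rw [hv]
  convert h using 2
  · ext φ
    simp only [map_smul, smul_eq_mul, Complex.ofReal_mul]
    ring_nf
  · push_cast
    ring

theorem IsFreeFieldMeasure.memLp_eval (hμ : IsFreeFieldMeasure hm μ) (f : 𝓢(SpaceTime d, ℝ)) :
    MemLp (fun φ : Field d => φ f) 2 μ := by
  have h := memLp_id_gaussianReal' (μ := 0) (v := (covForm d hm f).toNNReal) 2 (by simp)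
  rw [← hμ.map_eval f] at h
  exact (memLp_map_measure_iff (by fun_prop) (measurable_eval f).aemeasurable).mp h

/-- The random variables `φ ↦ φ(f)`, `f ∈ 𝓢(ℝ^{d+1})`, as a linear map into `L²(μ)`. -/
def IsFreeFieldMeasure.evalL2 (hμ : IsFreeFieldMeasure hm μ) :
    𝓢(SpaceTime d, ℝ) →ₗ[ℝ] Lp ℝ 2 μ where
  toFun f := (hμ.memLp_eval f).toLp _
  map_add' f g := by
    rw [← MemLp.toLp_add]
    congr 1
    ext φ; simp
  map_smul' c f := by
    rw [RingHom.id_apply, ← MemLp.toLp_const_smul]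
    congr 1
    ext φ; simp

theorem IsFreeFieldMeasure.norm_evalL2_le (hμ : IsFreeFieldMeasure hm μ)
    (f : 𝓢(SpaceTime d, ℝ)) :
    ‖hμ.evalL2 f‖ ≤ 1 / m * ‖SchwartzMap.toLpCLM ℝ ℝ 2 volume f‖ := by
  have := hμ.isProbabilityMeasure
  have hsq : ‖hμ.evalL2 f‖ ^ 2 = covForm d hm f := by
    have e1 : ‖hμ.evalL2 f‖ ^ 2 = ∫ φ : Field d, (φ f) ^ 2 ∂μ := by
      rw [← real_inner_self_eq_norm_sq, L2.inner_def]
      refine integral_congr_ae ?_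
      filter_upwards [(hμ.memLp_eval f).coeFn_toLp] with φ hφ
      change inner ℝ ((hμ.memLp_eval f).toLp _ φ) ((hμ.memLp_eval f).toLp _ φ) = _
      rw [hφ]
      simp [pow_two]
    have e2 : ∫ φ : Field d, (φ f) ^ 2 ∂μ
        = ∫ x, x ^ 2 ∂(gaussianReal 0 (covForm d hm f).toNNReal) := by
      rw [← hμ.map_eval f, integral_map (measurable_eval f).aemeasurable (by fun_prop)]
    have e3 := variance_fun_id_gaussianReal (μ := 0) (v := (covForm d hm f).toNNReal)
    rw [variance_eq_integral (by fun_prop)] at e3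
    simp only [integral_id_gaussianReal, sub_zero] at e3
    rw [e1, e2, e3, Real.coe_toNNReal _ (covForm_nonneg hm f)]
  have hb := covForm_le hm f
  rw [← hsq] at hb
  exact (sq_le_sq₀ (norm_nonneg _) (by positivity)).mp hb

/-- The random variable `φ(f) ∈ L²(μ)` for `f ∈ L²(ℝ^{d+1})`: the extension by continuity of
`f ↦ φ(f)` from the dense subspace of Schwartz functions. -/
def IsFreeFieldMeasure.smear (hμ : IsFreeFieldMeasure hm μ) :
    Lp ℝ 2 (volume : Measure (SpaceTime d)) →L[ℝ] Lp ℝ 2 μ :=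
  hμ.evalL2.extendOfNorm (SchwartzMap.toLpCLM ℝ ℝ 2 volume).toLinearMap

/-- On Schwartz functions the extension is the evaluation, so no junk value is involved. -/
theorem IsFreeFieldMeasure.smear_toLp (hμ : IsFreeFieldMeasure hm μ) (f : 𝓢(SpaceTime d, ℝ)) :
    hμ.smear (f.toLp 2 volume) =ᵐ[μ] fun φ => φ f := by
  have h : hμ.smear (f.toLp 2 volume) = hμ.evalL2 f :=
    LinearMap.extendOfNorm_eq (SchwartzMap.denseRange_toLpCLM (by simp))
      ⟨1 / m, hμ.norm_evalL2_le⟩ f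
  rw [h]
  exact (hμ.memLp_eval f).coeFn_toLp

/-- The centre `(n² / m, 0, …, 0)` of the `n`-th box. -/
def boxCenter (d : ℕ) (m : ℝ) (n : ℕ) : SpaceTime d :=
  EuclideanSpace.single 0 ((n : ℝ) ^ 2 / m)

/-- The `n`-th box `B_n`: the cube of side `L` centred at `(n² / m, 0, …, 0)` with sides parallel
to the coordinate axes. -/
def box (d : ℕ) (m L : ℝ) (n : ℕ) : Set (SpaceTime d) :=
  {x | ∀ k, |x k - boxCenter d m n k| ≤ L / 2}

theorem measurableSet_box (d : ℕ) (m L : ℝ) (n : ℕ) : MeasurableSet (box d m L n) := by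
  simp only [box, Set.ofPred_forall]
  exact MeasurableSet.iInter fun k => measurableSet_le (by fun_prop) (by fun_prop)

theorem volume_box_ne_top (d : ℕ) (m L : ℝ) (n : ℕ) : volume (box d m L n) ≠ ∞ := by
  refine (Bornology.IsBounded.measure_lt_top ?_).ne
  have h : Bornology.IsBounded (Set.pi Set.univ fun k : Fin (d + 1) =>
      Metric.closedBall (boxCenter d m n k) (L / 2)) :=
    Bornology.IsBounded.pi fun k => Metric.isBounded_closedBall
  refine ((PiLp.antilipschitzWith_ofLp 2 (fun _ : Fin (d + 1) => ℝ)).isBounded_preimage h).subset ?_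
  intro x hx k _
  exact hx k

/-- The function `f_n ∈ L²(ℝ^{d+1})`: the characteristic function of `B_n` divided by the volume
`L^{d+1}`. -/
def boxFun (d : ℕ) (m L : ℝ) (n : ℕ) : Lp ℝ 2 (volume : Measure (SpaceTime d)) :=
  indicatorConstLp 2 (measurableSet_box d m L n) (volume_box_ne_top d m L n) (1 / L ^ (d + 1))

/-- The random variable `φ(f_n)`, the mean value of the field `φ` over the box `B_n`. -/
def IsFreeFieldMeasure.boxAverage (hμ : IsFreeFieldMeasure hm μ) (L : ℝ) (n : ℕ) : Field d → ℝ :=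
  hμ.smear (boxFun d m L n)

/-- The constant `C_m^L`; the integrand is extended by `0` to the null set where some `p_k`
vanishes. -/
def boxVariance (d : ℕ) (m L : ℝ) : ℝ :=
  (2 / Real.pi) ^ (d + 1) * (1 / L ^ (2 * (d + 1))) *
    ∫ p : SpaceTime d, 1 / (‖p‖ ^ 2 + m ^ 2) * ∏ k, (Real.sin (p k * L / 2) ^ 2 / p k ^ 2)

end FreeField

end

/-!
Every `φ(f)` with `f ∈ L²` is a centred Gaussian variable: this holds by definition for Schwartz
`f`, and the laws converge along `L²`-limits of test functions (`IsFreeFieldMeasure.map_smear`).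

Its variance is the `L²`-continuous extension of the quadratic form `(f, C_m f)`. By Parseval this
form is `∫ |𝓕 f(ξ)|² / ((2π)²|ξ|² + m²) dξ`, with the `L²` Fourier transform of `f`
(`IsFreeFieldMeasure.norm_sq_smear`). For a box, which lies in `L¹ ∩ L²`, that transform is the
Fourier integral (`coeFn_fourier_toLp`), a product of one-dimensional `sin`-quotients up to a phase
that carries the position of the box; hence the variance is `C_m^L` for every `n`
(`IsFreeFieldMeasure.norm_sq_smear_boxFun`). It is nonzero since the propagator vanishes nowhere
(`IsFreeFieldMeasure.smear_ne_zero`).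

The growth bound uses only that the marginals are `N(0, C_m^L)`: the probability that
`|φ(f_n)| ≥ √(2(1+ε) C_m^L log n)` is at most `2 n^{-(1+ε)}`, and the Borel–Cantelli lemma applies
(`ae_eventually_abs_lt_of_map_eq_gaussianReal`). The joint law of the averages plays no role.
-/

namespace FreeField

open Filter Topology FourierTransform

/-! ### The law of the smeared field -/

theorem continuous_charFun_map_Lp {Ω : Type*} [MeasurableSpace Ω] {μ : Measure Ω}
    [IsProbabilityMeasure μ] (t : ℝ) :
    Continuous fun X : Lp ℝ 2 μ => charFun (μ.map X) t := by
  refine continuous_iff_seqContinuous.mpr fun X Y hXY => ?_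
  have h := (tendstoInMeasure_of_tendsto_Lp hXY).tendstoInDistribution
    fun n => (Lp.stronglyMeasurable (X n)).measurable.aemeasurable
  exact (ProbabilityMeasure.tendsto_iff_tendsto_charFun.mp h.tendsto) t

variable {d : ℕ} {m : ℝ} {hm : 0 < m} {μ : Measure (Field d)}

theorem IsFreeFieldMeasure.norm_sq_smear_toLp (hμ : IsFreeFieldMeasure hm μ)
    (f : 𝓢(SpaceTime d, ℝ)) :
    ‖hμ.smear (f.toLp 2 volume)‖ ^ 2 = covForm d hm f := by
  have e1 : ‖hμ.smear (f.toLp 2 volume)‖ ^ 2 = ∫ φ : Field d, (φ f) ^ 2 ∂μ := by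
    rw [← real_inner_self_eq_norm_sq, L2.inner_def]
    refine integral_congr_ae ?_
    filter_upwards [hμ.smear_toLp f] with φ hφ
    rw [hφ]
    simp [pow_two]
  have e2 : ∫ φ : Field d, (φ f) ^ 2 ∂μ
      = ∫ x, x ^ 2 ∂(gaussianReal 0 (covForm d hm f).toNNReal) := by
    rw [← hμ.map_eval f, integral_map (measurable_eval f).aemeasurable (by fun_prop)]
  have e3 := variance_fun_id_gaussianReal (μ := 0) (v := (covForm d hm f).toNNReal)
  rw [variance_eq_integral (by fun_prop)] at e3
  simp only [integral_id_gaussianReal, sub_zero] at e3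
  rw [e1, e2, e3, Real.coe_toNNReal _ (covForm_nonneg hm f)]

/-- The smeared field is a centred Gaussian variable for every test function in `L²`, because the
characteristic functions and the variances converge along `L²`-limits of Schwartz functions. -/
theorem IsFreeFieldMeasure.map_smear (hμ : IsFreeFieldMeasure hm μ)
    (f : Lp ℝ 2 (volume : Measure (SpaceTime d))) :
    μ.map (hμ.smear f) = gaussianReal 0 (‖hμ.smear f‖₊ ^ 2) := by
  have := hμ.isProbabilityMeasure
  have : IsProbabilityMeasure (μ.map (hμ.smear f)) :=
    Measure.isProbabilityMeasure_map (Lp.stronglyMeasurable _).measurable.aemeasurable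
  refine Measure.ext_of_charFun (funext fun t => ?_)
  rw [charFun_gaussianReal]
  refine (SchwartzMap.denseRange_toLpCLM (F := ℝ) (E := SpaceTime d) (μ := volume)
    (p := 2) ENNReal.ofNat_ne_top).induction_on
    (p := fun f => charFun (μ.map (hμ.smear f)) t
      = Complex.exp (t * (0 : ℝ) * Complex.I - ((‖hμ.smear f‖₊ ^ 2 : ℝ≥0) : ℝ) * t ^ 2 / 2)) f ?_ ?_
  · refine isClosed_eq ((continuous_charFun_map_Lp t).comp hμ.smear.continuous) ?_
    have := hμ.smear.continuous
    fun_prop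
  · intro u
    rw [SchwartzMap.toLpCLM_apply, Measure.map_congr (hμ.smear_toLp u), hμ.map_eval,
      charFun_gaussianReal, ← hμ.norm_sq_smear_toLp u]
    congr 6
    rw [Real.toNNReal_pow (norm_nonneg _), norm_toNNReal]

/-! ### The variance in momentum space -/

/-- The complexification of a real square-integrable function. -/
noncomputable def ofRealL2 (d : ℕ) :
    Lp ℝ 2 (volume : Measure (SpaceTime d)) →L[ℝ] Lp ℂ 2 (volume : Measure (SpaceTime d)) :=
  Complex.ofRealCLM.compLpL 2 volume

theorem coeFn_ofRealL2 (f : Lp ℝ 2 (volume : Measure (SpaceTime d))) :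
    ofRealL2 d f =ᵐ[volume] fun x => (f x : ℂ) :=
  Complex.ofRealCLM.coeFn_compLpL f

/-- The symbol of `(-Δ + m²)⁻¹` in the normalization `e^{-2πi⟨x,ξ⟩}` of the Fourier transform. -/
noncomputable def propagator (d : ℕ) (m : ℝ) (ξ : SpaceTime d) : ℝ :=
  ((2 * Real.pi) ^ 2 * ‖ξ‖ ^ 2 + m ^ 2)⁻¹

theorem propagator_pos (hm : 0 < m) (ξ : SpaceTime d) : 0 < propagator d m ξ := by
  unfold propagator; positivity

theorem continuous_propagator (hm : 0 < m) : Continuous (propagator d m) := by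
  unfold propagator
  exact Continuous.inv₀ (by fun_prop) fun ξ => by positivity

theorem memLp_top_propagator (hm : 0 < m) : MemLp (propagator d m) ∞ volume := by
  refine memLp_top_of_bound (continuous_propagator hm).aestronglyMeasurable (m ^ 2)⁻¹
    (Eventually.of_forall fun ξ => ?_)
  rw [Real.norm_of_nonneg (propagator_pos hm ξ).le, propagator]
  gcongr
  have : 0 ≤ (2 * Real.pi) ^ 2 * ‖ξ‖ ^ 2 := by positivity
  linarith

/-- Multiplication by the propagator, as a bounded operator on `L²`. -/
noncomputable def propagatorMul (d : ℕ) (hm : 0 < m) :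
    Lp ℂ 2 (volume : Measure (SpaceTime d)) →L[ℝ] Lp ℂ 2 (volume : Measure (SpaceTime d)) :=
  (ContinuousLinearMap.lsmul ℝ ℝ : ℝ →L[ℝ] ℂ →L[ℝ] ℂ).holderL volume ∞ 2 2
    (memLp_top_propagator hm).toLp

theorem coeFn_propagatorMul (hm : 0 < m) (g : Lp ℂ 2 (volume : Measure (SpaceTime d))) :
    propagatorMul d hm g =ᵐ[volume] fun ξ => (propagator d m ξ : ℂ) * g ξ := by
  filter_upwards [(ContinuousLinearMap.lsmul ℝ ℝ : ℝ →L[ℝ] ℂ →L[ℝ] ℂ).coeFn_holder (r := 2)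
    (memLp_top_propagator (d := d) hm).toLp g, (memLp_top_propagator (d := d) hm).coeFn_toLp]
    with ξ h1 h2
  refine h1.trans ?_
  simp [h2]

theorem re_inner_propagatorMul (hm : 0 < m) (g : Lp ℂ 2 (volume : Measure (SpaceTime d))) :
    (inner ℂ g (propagatorMul d hm g)).re = ∫ ξ, propagator d m ξ * ‖g ξ‖ ^ 2 := by
  have h : inner ℂ g (propagatorMul d hm g)
      = ∫ ξ, ((propagator d m ξ * ‖g ξ‖ ^ 2 : ℝ) : ℂ) := by
    rw [L2.inner_def]
    refine integral_congr_ae ?_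
    filter_upwards [coeFn_propagatorMul hm g] with ξ hξ
    rw [hξ, RCLike.inner_apply, mul_assoc, Complex.mul_conj, Complex.normSq_eq_norm_sq]
    push_cast
    rfl
  rw [h, integral_complex_ofReal, Complex.ofReal_re]

theorem fourier_postcomp_massiveOp (u : 𝓢(SpaceTime d, ℝ)) (ξ : SpaceTime d) :
    𝓕 ((massiveOp d m u).postcompCLM Complex.ofRealCLM) ξ
      = ((2 * Real.pi) ^ 2 * ‖ξ‖ ^ 2 + m ^ 2 : ℝ) * 𝓕 (u.postcompCLM Complex.ofRealCLM) ξ := by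
  have h1 : (massiveOp d m u).postcompCLM Complex.ofRealCLM
      = -(Δ (u.postcompCLM Complex.ofRealCLM)) + m ^ 2 • u.postcompCLM Complex.ofRealCLM := by
    ext x
    have hlap : (Δ (u.postcompCLM Complex.ofRealCLM)) x = ((Δ u) x : ℂ) := by
      rw [SchwartzMap.laplacian_apply, SchwartzMap.laplacian_apply]
      exact ((u.smooth 2).contDiffAt (x := x)).laplacian_CLM_comp_left (l := Complex.ofRealCLM)
    simp [massiveOp_apply, hlap, SchwartzMap.postcompCLM_apply]
  have hn : (fun ξ : SpaceTime d => ‖ξ‖ ^ 2).HasTemperateGrowth := by fun_prop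
  rw [h1, FourierTransform.fourier_add, SchwartzMap.laplacian_eq_fourierMultiplierCLM,
    SchwartzMap.fourierMultiplierCLM_apply, FourierTransform.fourier_neg,
    FourierTransform.fourier_smul, FourierTransform.fourier_smul,
    FourierTransform.fourier_fourierInv_eq]
  simp [SchwartzMap.smulLeftCLM_apply_apply hn]
  ring

/-- The quadratic form of the covariance in momentum space, by Parseval's identity. -/
theorem covForm_eq_integral (f : 𝓢(SpaceTime d, ℝ)) :
    covForm d hm f
      = ∫ ξ, propagator d m ξ * ‖𝓕 (f.postcompCLM Complex.ofRealCLM) ξ‖ ^ 2 := by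
  set u := covOp d hm f with hu
  have hP := SchwartzMap.integral_inner_fourier_fourier
    (f.postcompCLM Complex.ofRealCLM) (u.postcompCLM Complex.ofRealCLM)
  have hF : ∀ ξ, inner ℂ (𝓕 (f.postcompCLM Complex.ofRealCLM) ξ)
      (𝓕 (u.postcompCLM Complex.ofRealCLM) ξ)
      = ((propagator d m ξ * ‖𝓕 (f.postcompCLM Complex.ofRealCLM) ξ‖ ^ 2 : ℝ) : ℂ) := by
    intro ξ
    have h := fourier_postcomp_massiveOp (m := m) u ξ
    rw [massiveOp_covOp] at h
    have hp := propagator_pos (d := d) hm ξ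
    have hU : 𝓕 (u.postcompCLM Complex.ofRealCLM) ξ
        = (propagator d m ξ : ℂ) * 𝓕 (f.postcompCLM Complex.ofRealCLM) ξ := by
      rw [h, ← mul_assoc, ← Complex.ofReal_mul, propagator, inv_mul_cancel₀ (by positivity)]
      simp
    rw [hU, RCLike.inner_apply, mul_assoc, Complex.mul_conj, Complex.normSq_eq_norm_sq]
    push_cast
    rfl
  simp_rw [hF] at hP
  rw [integral_complex_ofReal] at hP
  have hR : ∀ x, inner ℂ (f.postcompCLM Complex.ofRealCLM x) (u.postcompCLM Complex.ofRealCLM x)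
      = ((f x * u x : ℝ) : ℂ) := by
    intro x
    simp [SchwartzMap.postcompCLM_apply, mul_comm]
  simp_rw [hR] at hP
  rw [integral_complex_ofReal] at hP
  exact (Complex.ofReal_injective hP).symm

/-- The second moment of the smeared field in momentum space. Both sides are continuous in
`f ∈ L²`, so the Schwartz case suffices. -/
theorem IsFreeFieldMeasure.norm_sq_smear (hμ : IsFreeFieldMeasure hm μ)
    (f : Lp ℝ 2 (volume : Measure (SpaceTime d))) :
    ‖hμ.smear f‖ ^ 2 = ∫ ξ, propagator d m ξ * ‖𝓕 (ofRealL2 d f) ξ‖ ^ 2 := by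
  rw [← re_inner_propagatorMul hm]
  refine (SchwartzMap.denseRange_toLpCLM (F := ℝ) (E := SpaceTime d) (μ := volume)
    (p := 2) ENNReal.ofNat_ne_top).induction_on
    (p := fun f => ‖hμ.smear f‖ ^ 2 = (inner ℂ (𝓕 (ofRealL2 d f))
      (propagatorMul d hm (𝓕 (ofRealL2 d f)))).re) f ?_ ?_
  · have hF : Continuous fun f : Lp ℝ 2 (volume : Measure (SpaceTime d)) => 𝓕 (ofRealL2 d f) :=
      (Lp.fourierTransformₗᵢ (SpaceTime d) ℂ).continuous.comp (ofRealL2 d).continuous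
    refine isClosed_eq (hμ.smear.continuous.norm.pow 2) ?_
    exact Complex.continuous_re.comp
      (hF.inner ((propagatorMul d hm).continuous.comp hF))
  · intro u
    rw [SchwartzMap.toLpCLM_apply, hμ.norm_sq_smear_toLp, covForm_eq_integral,
      re_inner_propagatorMul]
    have h1 : ofRealL2 d (u.toLp 2 volume) = (u.postcompCLM Complex.ofRealCLM).toLp 2 volume := by
      refine Lp.ext ?_
      filter_upwards [coeFn_ofRealL2 (u.toLp 2 volume), u.coeFn_toLp 2 volume,
        (u.postcompCLM Complex.ofRealCLM).coeFn_toLp 2 volume] with x h1 h2 h3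
      rw [h1, h2, h3]
      simp [SchwartzMap.postcompCLM_apply]
    rw [h1, SchwartzMap.toLp_fourier_eq]
    refine integral_congr_ae ?_
    filter_upwards [(𝓕 (u.postcompCLM Complex.ofRealCLM)).coeFn_toLp 2 volume] with ξ hξ
    rw [hξ]

/-! ### The Fourier transform of a box -/

/-- On `L¹ ∩ L²` the `L²` Fourier transform is given by the Fourier integral: paired with a test
function, both can be moved onto the test function. -/
theorem coeFn_fourier_toLp {f : SpaceTime d → ℂ} (h1 : Integrable f) (h2 : MemLp f 2 volume) :
    ((𝓕 (h2.toLp f) : Lp ℂ 2 (volume : Measure (SpaceTime d))) : SpaceTime d → ℂ)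
      =ᵐ[volume] 𝓕 f := by
  set F : Lp ℂ 2 (volume : Measure (SpaceTime d)) := 𝓕 (h2.toLp f)
  have hL : LocallyIntegrable (fun x => F x) volume :=
    (Lp.memLp F).locallyIntegrable (by norm_num)
  have hc : Continuous (𝓕 f) :=
    VectorFourier.fourierIntegral_continuous Real.continuous_fourierChar
      (by exact continuous_inner) h1
  refine ae_eq_of_integral_contDiff_smul_eq (f' := 𝓕 f) hL hc.locallyIntegrable
    fun g hg hg' => ?_
  have hg₁ : HasCompactSupport (Complex.ofRealCLM ∘ g) := hg'.comp_left rfl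
  have hg₂ := Complex.ofRealCLM.contDiff.comp hg
  set G := hg₁.toSchwartzMap hg₂ with hG
  have hD := congrArg (fun T => T G) (Lp.fourier_toTemperedDistribution_eq (h2.toLp f))
  have hS := VectorFourier.integral_fourierIntegral_smul_eq_flip (μ := volume) (ν := volume)
    (L := innerₗ (SpaceTime d)) (f := G) (g := f)
    Real.continuous_fourierChar (by exact continuous_inner) G.integrable h1
  calc ∫ x, g x • F x = ∫ x, G x • F x := by
        simp [hG]
    _ = ∫ x, 𝓕 G x • (h2.toLp f) x := by
        simpa using hD.symm
    _ = ∫ x, 𝓕 G x • f x := by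
        refine integral_congr_ae ?_
        filter_upwards [h2.coeFn_toLp] with x hx
        rw [hx]
    _ = ∫ x, G x • 𝓕 f x := by
        simpa [SchwartzMap.fourier_coe] using! hS
    _ = ∫ x, g x • 𝓕 f x := by
        simp [hG]

/-- The normalized indicator function of the interval of length `L` centred at `c`. -/
noncomputable def intervalFun (L c : ℝ) : ℝ → ℂ :=
  (Set.Icc (c - L / 2) (c + L / 2)).indicator fun _ => (1 / L : ℂ)

theorem integral_exp_mul_intervalFun {L : ℝ} (hL : 0 < L) (c s : ℝ) :
    ∫ x : ℝ, Complex.exp (-(2 * Real.pi * s * Complex.I) * x) * intervalFun L c x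
      = 1 / L * ∫ x in (c - L / 2)..(c + L / 2),
        Complex.exp (-(2 * Real.pi * s * Complex.I) * x) := by
  rw [intervalIntegral.integral_of_le (by linarith), ← integral_Icc_eq_integral_Ioc,
    ← integral_const_mul, ← integral_indicator measurableSet_Icc]
  refine integral_congr_ae (Eventually.of_forall fun x => ?_)
  by_cases hx : x ∈ Set.Icc (c - L / 2) (c + L / 2)
  · simp [intervalFun, hx, mul_comm]
  · simp [intervalFun, hx]

theorem norm_sq_integral_exp_mul_intervalFun {L : ℝ} (hL : 0 < L) (c : ℝ) {s : ℝ} (hs : s ≠ 0) :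
    ‖∫ x : ℝ, Complex.exp (-(2 * Real.pi * s * Complex.I) * x) * intervalFun L c x‖ ^ 2
      = Real.sin (Real.pi * s * L) ^ 2 / (Real.pi * s * L) ^ 2 := by
  have ha : -(2 * Real.pi * s * Complex.I : ℂ) ≠ 0 := by
    simp [hs, Real.pi_ne_zero]
  have hπs : (Real.pi * s : ℂ) ≠ 0 := by simp [hs, Real.pi_ne_zero]
  have hLC : (L : ℂ) ≠ 0 := by exact_mod_cast hL.ne'
  rw [integral_exp_mul_intervalFun hL, integral_exp_mul_complex ha]
  -- The phase coming from the centre `c` is factored out of the sine of the half-length.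
  have key : (1 / L : ℂ) * ((Complex.exp (-(2 * Real.pi * s * Complex.I) * ((c + L / 2 : ℝ) : ℂ))
      - Complex.exp (-(2 * Real.pi * s * Complex.I) * ((c - L / 2 : ℝ) : ℂ)))
        / -(2 * Real.pi * s * Complex.I))
      = Complex.exp ((-(2 * Real.pi * s * c) : ℝ) * Complex.I)
        * ((Real.sin (Real.pi * s * L) / (Real.pi * s * L) : ℝ) : ℂ) := by
    have e1 : (-(2 * Real.pi * s * Complex.I) * ((c + L / 2 : ℝ) : ℂ) : ℂ)
        = (-(2 * Real.pi * s * c) : ℝ) * Complex.I + -(Real.pi * s * L : ℝ) * Complex.I := by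
      push_cast; ring
    have e2 : (-(2 * Real.pi * s * Complex.I) * ((c - L / 2 : ℝ) : ℂ) : ℂ)
        = (-(2 * Real.pi * s * c) : ℝ) * Complex.I + (Real.pi * s * L : ℝ) * Complex.I := by
      push_cast; ring
    rw [e1, e2, Complex.exp_add, Complex.exp_add, Complex.ofReal_div, Complex.ofReal_sin,
      Complex.sin]
    push_cast
    field_simp
    rw [Complex.I_sq]
    ring
  rw [key, norm_mul, Complex.norm_exp_ofReal_mul_I, one_mul, Complex.norm_real,
    Real.norm_eq_abs, sq_abs, div_pow]

/-- The function `L^{-(d+1)} 1_{B_n}` as a product of functions of one coordinate each. -/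
noncomputable def boxProd (d : ℕ) (m L : ℝ) (n : ℕ) (x : SpaceTime d) : ℂ :=
  ∏ k, intervalFun L (boxCenter d m n k) (x k)

theorem boxProd_eq_indicator (d : ℕ) (m L : ℝ) (n : ℕ) :
    boxProd d m L n = (box d m L n).indicator fun _ => ((1 / L ^ (d + 1) : ℝ) : ℂ) := by
  ext x
  have hI : ∀ k, x k ∈ Set.Icc (boxCenter d m n k - L / 2) (boxCenter d m n k + L / 2)
      ↔ |x k - boxCenter d m n k| ≤ L / 2 := fun k => by
    rw [abs_le, Set.mem_Icc]
    constructor <;> rintro ⟨h1, h2⟩ <;> constructor <;> linarith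
  by_cases hx : x ∈ box d m L n
  · have hk : ∀ k, intervalFun L (boxCenter d m n k) (x k) = 1 / L := fun k =>
      Set.indicator_of_mem ((hI k).mpr (hx k)) _
    rw [Set.indicator_of_mem hx, boxProd, Finset.prod_congr rfl fun k _ => hk k]
    simp
  · rw [Set.indicator_of_notMem hx]
    obtain ⟨k, hk⟩ := not_forall.mp hx
    exact Finset.prod_eq_zero (Finset.mem_univ k)
      (Set.indicator_of_notMem (fun h => hk ((hI k).mp h)) _)

theorem memLp_boxProd (d : ℕ) (m L : ℝ) (n : ℕ) (p : ℝ≥0∞) :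
    MemLp (boxProd d m L n) p volume := by
  rw [boxProd_eq_indicator]
  exact memLp_indicator_const p (measurableSet_box d m L n) _ (Or.inr (volume_box_ne_top d m L n))

theorem ofRealL2_boxFun (d : ℕ) (m L : ℝ) (n : ℕ) :
    ofRealL2 d (boxFun d m L n) = (memLp_boxProd d m L n 2).toLp := by
  refine Lp.ext ?_
  filter_upwards [coeFn_ofRealL2 (boxFun d m L n), (memLp_boxProd d m L n 2).coeFn_toLp,
    indicatorConstLp_coeFn (p := 2) (hs := measurableSet_box d m L n)
      (hμs := volume_box_ne_top d m L n) (c := (1 / L ^ (d + 1) : ℝ))] with x h1 h2 h3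
  rw [h1, h2, boxFun, h3, boxProd_eq_indicator]
  by_cases hx : x ∈ box d m L n <;> simp [hx]

theorem fourier_boxProd (d : ℕ) (m L : ℝ) (n : ℕ) (ξ : SpaceTime d) :
    𝓕 (boxProd d m L n) ξ = ∏ k, ∫ x : ℝ,
      Complex.exp (-(2 * Real.pi * ξ k * Complex.I) * x)
        * intervalFun L (boxCenter d m n k) x := by
  rw [Real.fourier_eq', ← integral_fintype_prod_volume_eq_prod (fun k (x : ℝ) =>
    Complex.exp (-(2 * Real.pi * ξ k * Complex.I) * x) * intervalFun L (boxCenter d m n k) x),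
    ← (PiLp.volume_preserving_toLp (Fin (d + 1))).integral_comp
      (MeasurableEquiv.toLp 2 _).measurableEmbedding]
  refine integral_congr_ae (Eventually.of_forall fun x => ?_)
  simp only [boxProd, smul_eq_mul]
  rw [Finset.prod_mul_distrib, ← Complex.exp_sum]
  congr 2
  simp only [PiLp.inner_apply, RCLike.inner_apply, conj_trivial, Complex.ofReal_mul,
    Complex.ofReal_sum, Finset.mul_sum, Finset.sum_mul]
  refine Finset.sum_congr rfl fun k _ => ?_
  push_cast
  ring

theorem ae_forall_coord_ne_zero (d : ℕ) : ∀ᵐ ξ : SpaceTime d, ∀ k, ξ k ≠ 0 := by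
  rw [ae_all_iff]
  intro k
  have h : ∀ᵐ y : Fin (d + 1) → ℝ, y k ≠ 0 := Measure.ae_eval_ne (fun _ => volume) k 0
  exact (PiLp.volume_preserving_ofLp (Fin (d + 1))).quasiMeasurePreserving.ae h

theorem norm_sq_fourier_boxFun {L : ℝ} (hL : 0 < L) (n : ℕ) :
    ∀ᵐ ξ, ‖𝓕 (ofRealL2 d (boxFun d m L n)) ξ‖ ^ 2
      = ∏ k, Real.sin (Real.pi * ξ k * L) ^ 2 / (Real.pi * ξ k * L) ^ 2 := by
  rw [ofRealL2_boxFun]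
  filter_upwards [coeFn_fourier_toLp ((memLp_one_iff_integrable).mp (memLp_boxProd d m L n 1))
    (memLp_boxProd d m L n 2), ae_forall_coord_ne_zero d] with ξ h1 h2
  rw [h1, fourier_boxProd, norm_prod, ← Finset.prod_pow]
  exact Finset.prod_congr rfl fun k _ => norm_sq_integral_exp_mul_intervalFun hL _ (h2 k)

/-- The substitution `p = 2πξ` turns the momentum integral into the constant `C_m^L`. -/
theorem integral_propagator_mul_prod {L : ℝ} (hL : 0 < L) :
    ∫ ξ : SpaceTime d, propagator d m ξ
        * ∏ k, Real.sin (Real.pi * ξ k * L) ^ 2 / (Real.pi * ξ k * L) ^ 2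
      = boxVariance d m L := by
  have hπ := Real.pi_pos
  have h := Measure.integral_comp_smul (volume : Measure (SpaceTime d))
    (fun p => 1 / (‖p‖ ^ 2 + m ^ 2) * ∏ k, (Real.sin (p k * L / 2) ^ 2 / p k ^ 2)) (2 * Real.pi)
  have hf : ∀ ξ : SpaceTime d, propagator d m ξ
        * ∏ k, Real.sin (Real.pi * ξ k * L) ^ 2 / (Real.pi * ξ k * L) ^ 2
      = (4 / L ^ 2) ^ (d + 1) * (1 / (‖(2 * Real.pi) • ξ‖ ^ 2 + m ^ 2) *
        ∏ k, (Real.sin (((2 * Real.pi) • ξ) k * L / 2) ^ 2 / ((2 * Real.pi) • ξ) k ^ 2)) := by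
    intro ξ
    have e : ∀ k, Real.sin (Real.pi * ξ k * L) ^ 2 / (Real.pi * ξ k * L) ^ 2
        = 4 / L ^ 2 * (Real.sin (((2 * Real.pi) • ξ) k * L / 2) ^ 2
          / ((2 * Real.pi) • ξ) k ^ 2) := by
      intro k
      rw [PiLp.smul_apply, smul_eq_mul,
        show 2 * Real.pi * ξ k * L / 2 = Real.pi * ξ k * L by ring]
      -- At `ξ k = 0` both quotients take the value `0 / 0 = 0`.
      rcases eq_or_ne (ξ k) 0 with h0 | h0
      · simp [h0]
      · field_simp
        ring
    simp_rw [e, Finset.prod_mul_distrib, Finset.prod_const, Finset.card_univ, Fintype.card_fin]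
    rw [propagator, norm_smul, Real.norm_of_nonneg (by positivity), mul_pow]
    ring
  simp_rw [hf]
  rw [integral_const_mul, h, boxVariance, finrank_euclideanSpace_fin, smul_eq_mul,
    abs_of_pos (by positivity), ← mul_assoc]
  congr 1
  rw [← inv_pow, ← mul_pow, pow_mul, ← one_div_pow, ← mul_pow]
  congr 1
  field_simp
  norm_num

/-! ### The variance of a box average -/

theorem IsFreeFieldMeasure.norm_sq_smear_boxFun (hμ : IsFreeFieldMeasure hm μ) {L : ℝ}
    (hL : 0 < L) (n : ℕ) : ‖hμ.smear (boxFun d m L n)‖ ^ 2 = boxVariance d m L := by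
  rw [hμ.norm_sq_smear, ← integral_propagator_mul_prod hL]
  refine integral_congr_ae ?_
  filter_upwards [norm_sq_fourier_boxFun hL n] with ξ hξ
  rw [hξ]

/-- The covariance is strictly positive, because the propagator vanishes nowhere. -/
theorem IsFreeFieldMeasure.smear_ne_zero (hμ : IsFreeFieldMeasure hm μ)
    {f : Lp ℝ 2 (volume : Measure (SpaceTime d))} (hf : f ≠ 0) : hμ.smear f ≠ 0 := by
  intro h0
  have h := hμ.norm_sq_smear f
  set g : Lp ℂ 2 (volume : Measure (SpaceTime d)) := 𝓕 (ofRealL2 d f) with hg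
  have hi : Integrable (fun ξ => propagator d m ξ * ‖g ξ‖ ^ 2) volume := by
    have h2 : Integrable (fun ξ => ‖g ξ‖ ^ 2) volume := (Lp.memLp g).integrable_norm_pow two_ne_zero
    exact h2.mul_of_top_right (memLp_top_propagator hm)
  rw [h0, norm_zero, zero_pow two_ne_zero, eq_comm, integral_eq_zero_iff_of_nonneg
    (fun ξ => mul_nonneg (propagator_pos hm ξ).le (sq_nonneg _)) hi] at h
  have hg0 : g = 0 := by
    refine Lp.ext ?_
    filter_upwards [h, Lp.coeFn_zero ℂ 2 (volume : Measure (SpaceTime d))] with ξ h1 h2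
    rw [h2]
    simpa [(propagator_pos (d := d) hm ξ).ne'] using h1
  have hf0 : ofRealL2 d f = 0 := by
    have := Lp.norm_fourier_eq (ofRealL2 d f)
    rw [← hg, hg0, norm_zero] at this
    exact norm_eq_zero.mp this.symm
  refine hf (Lp.ext ?_)
  filter_upwards [coeFn_ofRealL2 f, Lp.coeFn_zero ℂ 2 (volume : Measure (SpaceTime d)),
    Lp.coeFn_zero ℝ 2 (volume : Measure (SpaceTime d))] with x h1 h2 h3
  rw [hf0, h2] at h1
  rw [h3]
  simpa using h1.symm

theorem boxFun_ne_zero {L : ℝ} (hL : 0 < L) (n : ℕ) : boxFun d m L n ≠ 0 := by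
  have hv : volume (box d m L n) ≠ 0 := by
    have hsub : Metric.ball (boxCenter d m n) (L / 2) ⊆ box d m L n := fun x hx k => by
      have h1 := PiLp.norm_apply_le (x - boxCenter d m n) k
      rw [mem_ball_iff_norm] at hx
      exact h1.trans hx.le
    exact ((Metric.measure_ball_pos volume _ (half_pos hL)).trans_le (measure_mono hsub)).ne'
  rw [← norm_ne_zero_iff, boxFun, norm_indicatorConstLp' two_ne_zero hv]
  have h2 : 0 < volume.real (box d m L n) := ENNReal.toReal_pos hv (volume_box_ne_top d m L n)
  have h3 : 0 < ‖1 / L ^ (d + 1)‖ := norm_pos_iff.mpr (by positivity)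
  exact (mul_pos h3 (Real.rpow_pos_of_pos h2 _)).ne'

/-! ### Gaussian tails and the Borel–Cantelli lemma -/

theorem measureReal_le_abs_of_map_eq_gaussianReal {Ω : Type*} [MeasurableSpace Ω] {P : Measure Ω}
    [IsProbabilityMeasure P] {X : Ω → ℝ} {v : ℝ≥0} (hXm : AEMeasurable X P)
    (hX : P.map X = gaussianReal 0 v) {t : ℝ} (ht : 0 ≤ t) :
    P.real {ω | t ≤ |X ω|} ≤ 2 * Real.exp (-t ^ 2 / (2 * v)) := by
  have hsub : HasSubgaussianMGF X v P := by
    refine ⟨fun s => ?_, fun s => ?_⟩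
    · have h := integrable_exp_mul_gaussianReal (μ := 0) (v := v) s
      rw [← hX] at h
      exact h.comp_aemeasurable hXm
    · rw [mgf_gaussianReal hX]
      simp
  have hu : {ω | t ≤ |X ω|} ⊆ {ω | t ≤ X ω} ∪ {ω | t ≤ (-X) ω} := fun ω hω => by
    simpa [le_abs] using hω
  calc P.real {ω | t ≤ |X ω|} ≤ P.real {ω | t ≤ X ω} + P.real {ω | t ≤ (-X) ω} :=
        (measureReal_mono hu).trans (measureReal_union_le _ _)
    _ ≤ _ := by linarith [hsub.measure_ge_le ht, hsub.neg.measure_ge_le ht]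

/-- A sequence of centred Gaussian variables of common variance `v`, of arbitrary joint law, is
eventually below `√(2(1+ε) v log n)`: the tail bounds are `2 n^{-(1+ε)}`, hence summable, and the
Borel–Cantelli lemma applies. -/
theorem ae_eventually_abs_lt_of_map_eq_gaussianReal {Ω : Type*} [MeasurableSpace Ω]
    {P : Measure Ω} [IsProbabilityMeasure P] {X : ℕ → Ω → ℝ} {v : ℝ≥0} (hv : 0 < v)
    (hXm : ∀ n, AEMeasurable (X n) P) (hX : ∀ n, P.map (X n) = gaussianReal 0 v)
    {ε : ℝ} (hε : 0 < ε) :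
    ∀ᵐ ω ∂P, ∀ᶠ n : ℕ in atTop, |X n ω| < √(2 * (1 + ε) * v * Real.log n) := by
  have hb : ∀ n : ℕ, P {ω | √(2 * (1 + ε) * v * Real.log n) ≤ |X n ω|}
      ≤ ENNReal.ofReal (2 * Real.exp (-(1 + ε) * Real.log n)) := by
    intro n
    rw [← ofReal_measureReal]
    refine ENNReal.ofReal_le_ofReal
      ((measureReal_le_abs_of_map_eq_gaussianReal (hXm n) (hX n) (Real.sqrt_nonneg _)).trans ?_)
    have hv' : (0 : ℝ) < v := hv
    have hlog : 0 ≤ Real.log n := Real.log_natCast_nonneg n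
    rw [Real.sq_sqrt (by positivity)]
    apply le_of_eq
    congr 2
    field_simp
  -- At `n = 0` the exponential is `1`, not `0 ^ (-(1 + ε))`, so the two series only agree eventually.
  have hs : Summable fun n : ℕ => 2 * Real.exp (-(1 + ε) * Real.log n) := by
    refine ((Real.summable_nat_rpow (p := -(1 + ε))).mpr (by linarith)).congr_atTop ?_
      |>.mul_left 2
    filter_upwards [eventually_gt_atTop 0] with n hn
    rw [Real.rpow_def_of_pos (by exact_mod_cast hn), mul_comm]
  have hfin := ne_top_of_le_ne_top hs.tsum_ofReal_ne_top (ENNReal.tsum_le_tsum hb)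
  filter_upwards [ae_eventually_notMem hfin] with ω hω
  exact hω.mono fun n hn => not_le.mp hn

end FreeField

theorem proposition2 (d : ℕ) {m : ℝ} (hm : 0 < m) {L : ℝ} (hL : 0 < L)
    (μ : Measure (FreeField.Field d)) (hμ : FreeField.IsFreeFieldMeasure hm μ) :
    (∀ n : ℕ, Var[hμ.boxAverage L n; μ] = FreeField.boxVariance d m L) ∧
      ∀ ε : ℝ, 0 < ε →
        μ {φ | ∃ N : ℕ, ∀ n : ℕ, N ≤ n →
          |hμ.boxAverage L n φ| <
            Real.sqrt (2 * (1 + ε) * FreeField.boxVariance d m L * Real.log n)} = 1 := by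
  have := hμ.isProbabilityMeasure
  have hmeas : ∀ n, AEMeasurable (hμ.boxAverage L n) μ := fun n =>
    (Lp.stronglyMeasurable _).measurable.aemeasurable
  have hpos : 0 < FreeField.boxVariance d m L := by
    rw [← hμ.norm_sq_smear_boxFun hL 0]
    exact pow_pos (norm_pos_iff.mpr (hμ.smear_ne_zero (FreeField.boxFun_ne_zero hL 0))) 2
  lift FreeField.boxVariance d m L to ℝ≥0 using hpos.le with v hv
  have hlaw : ∀ n, μ.map (hμ.boxAverage L n) = gaussianReal 0 v := fun n => by
    have hn : ‖hμ.smear (FreeField.boxFun d m L n)‖₊ ^ 2 = v := by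
      rw [← NNReal.coe_inj, hv, ← hμ.norm_sq_smear_boxFun hL n, NNReal.coe_pow, coe_nnnorm]
    rw [← hn]
    exact hμ.map_smear _
  refine ⟨fun n => ?_, fun ε hε => ?_⟩
  · rw [← variance_id_map (hmeas n), hlaw n, variance_id_gaussianReal]
  · have h := FreeField.ae_eventually_abs_lt_of_map_eq_gaussianReal
      (NNReal.coe_pos.mp hpos) hmeas hlaw hε
    rw [← measure_univ (μ := μ)]
    refine measure_congr (Filter.eventuallyEq_univ.mpr ?_)
    filter_upwards [h] with φ hφ using Filter.eventually_atTop.mp hφ
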